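/- All multigraphs are loopless. A harmonious total colouring of a multigraph $G$ assigns a colour to every vertex and every edge of $G$ such that adjacent vertices receive different colours, any two distinct edges sharing an end vertex (in particular parallel edges) receive different colours, every edge and each of its end vertices receive different colours, and, whenever $(x,e)\neq(y,f)$ are two distinct pairs consisting of a vertex and an edge incident with it, the unordered pairs of colours $\{c(x),c(e)\}$ and $\{c(y),c(f)\}$ are different. The harmonious total chromatic number $h_t(G)$ is the smallest number of colours in a harmonious total colouring of $G$. For integers $n\ge 1$ and $\lambda\geq 1$, the complete multigraph $\lambda K_n$ has $n$ vertices, and every two distinct vertices are joined by exactly $\lambda$ edges. **Theorem.** Let $\lambda\ge 1$ be an integer. For every integer $n\ge 2$ with $n\ne 4$, $$h_t(\lambda K_n)=(\lambda-1)\left(2\left\lceil \frac n2\right\rceil-1\right)+\left\lceil\frac{3n}{2}\right\rceil,$$ and $h_t(\lambda K_4)=3\lambda+4$. -/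

import Mathlib

open scoped Graph

/-- `cV`, `cE` (colours of the vertices and of the edges of the multigraph `G`) form a
*proper total colouring*: distinct adjacent vertices, distinct edges sharing an end vertex
(in particular parallel edges), and a vertex and an edge incident to it receive different
colours. -/
structure IsProperTotalColouring {α β C : Type*} (G : Graph α β)
    (cV : V(G) → C) (cE : E(G) → C) : Prop where
  vertex_ne : ∀ x y : V(G), x ≠ y → G.Adj x y → cV x ≠ cV y
  edge_ne : ∀ (e f : E(G)) (x : V(G)), e ≠ f → G.Inc e x → G.Inc f x → cE e ≠ cE f
  incident_ne : ∀ (x : V(G)) (e : E(G)), G.Inc e x → cV x ≠ cE e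

/-- A *harmonious total colouring*: a proper total colouring such that different incident
vertex-edge pairs have different unordered pairs of colours. -/
structure IsHarmoniousTotalColouring {α β C : Type*} (G : Graph α β)
    (cV : V(G) → C) (cE : E(G) → C) : Prop extends IsProperTotalColouring G cV cE where
  pair_unique : ∀ (x y : V(G)) (e f : E(G)), G.Inc e x → G.Inc f y →
    s(cV x, cE e) = s(cV y, cE f) → x = y ∧ e = f

/-- `G` has a harmonious total colouring with colours taken from a set of `k` colours. -/
def HarmoniousTotalColourable {α β : Type*} (G : Graph α β) (k : ℕ) : Prop :=
  ∃ (cV : V(G) → Fin k) (cE : E(G) → Fin k), IsHarmoniousTotalColouring G cV cE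

/-- The *harmonious total chromatic number* of `G`: the least number of colours in a harmonious
total colouring (`⊤` if finitely many colours never suffice). -/
noncomputable def harmoniousTotalChromaticNumber {α β : Type*} (G : Graph α β) : ℕ∞ :=
  ⨅ (k : ℕ) (_ : HarmoniousTotalColourable G k), (k : ℕ∞)

/-- The complete multigraph on `n` vertices in which any two distinct vertices are joined by
exactly `l` edges: the edges are the pairs `(p, i)` of an unordered pair `p` of distinct vertices
and a label `i` among `l` labels, and `(p, i)` joins the two elements of `p`. -/
def completeMultigraph (n l : ℕ) :
    Graph (Fin n) ({p : Sym2 (Fin n) // ¬ p.IsDiag} × Fin l) where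
  vertexSet := Set.univ
  edgeSet := Set.univ
  IsLink e x y := e.1.1 = s(x, y)
  isLink_symm e _ := ⟨fun x y h => h.trans Sym2.eq_swap⟩
  eq_or_eq_of_isLink_of_isLink e x y v w h h' := by
    rcases Sym2.eq_iff.1 (h.symm.trans h') with h1 | h1
    · exact Or.inl h1.1
    · exact Or.inr h1.1
  edge_mem_iff_exists_isLink e := by
    refine ⟨fun _ => ?_, fun _ => Set.mem_univ e⟩
    obtain ⟨⟨p, hp⟩, i⟩ := e
    induction p using Sym2.ind with
    | _ x y => exact ⟨x, y, rfl⟩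
  left_mem_of_isLink _ x _ _ := Set.mem_univ x

/-! Vertex colours are pairwise distinct, so they may be identified with the vertices. Draw an arc
from `z` to `x` when some edge at `x` has the colour of `z`. Harmony says exactly that this digraph
has no loops and no opposite arcs, and that no arc arises from two edges.

Lower bound (`IsHarmoniousFunctions.card_le`): count incident vertex-edge pairs. Those whose edge
has a vertex colour give distinct arcs, so there are at most `n.choose 2` of them; each of the other
`k - n` colours is a matching and accounts for at most `2 * (n / 2)`. Rounding up gives the formula.
For `n = 4` this is one short: vertex-coloured edges cannot occur on two disjoint pairs, so a star
or a triangle avoids vertex colours and needs `3 * l` others.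

Upper bound (`IsHarmoniousRelation.colourable`): one copy of `K_n` is coloured harmoniously, and
every further copy gets its own fresh optimal proper edge colouring. The harmonious colouring of
`K_n` is an explicit cyclic construction for each residue of `n` modulo 4, making the arcs nearly a
tournament and the colour classes nearly perfect matchings. -/

/-! ### From functions on vertices to colourings of the multigraph -/

theorem completeMultigraph_inc_iff {n l : ℕ} {p : {p : Sym2 (Fin n) // ¬ p.IsDiag}} {i : Fin l}
    {x : Fin n} : (completeMultigraph n l).Inc (p, i) x ↔ x ∈ p.1 := by
  constructor
  · rintro ⟨y, hy⟩
    change p.1 = s(x, y) at hy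
    simp [hy]
  · rintro ⟨y, hy⟩
    exact ⟨y, hy⟩

/-- The colours of a harmonious total colouring of a complete multigraph, as functions on the
vertices. -/
structure IsHarmoniousFunctions {n l : ℕ} {C : Type*} (v : Fin n → C)
    (c : Fin n → Fin n → Fin l → C) : Prop where
  injective : Function.Injective v
  symm : ∀ x y i, c x y i = c y x i
  proper : ∀ x y z i j, y ≠ x → z ≠ x → c x y i = c x z j → y = z ∧ i = j
  incident : ∀ x y i, y ≠ x → v x ≠ c x y i
  pair : ∀ x y z w i j, y ≠ x → w ≠ z → v x = c z w j → v z ≠ c x y i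

/-- A harmonious total colouring of `completeMultigraph n l` from the colours of the vertices and
edges as functions on the vertices. -/
theorem harmoniousTotalColourable_of_functions {n l : ℕ} {C : Type*} [Fintype C]
    {v : Fin n → C} {c : Fin n → Fin n → Fin l → C} (h : IsHarmoniousFunctions v c) :
    HarmoniousTotalColourable (completeMultigraph n l) (Fintype.card C) := by
  let φ := Fintype.equivFin C
  let cE : E(completeMultigraph n l) → C := fun e =>
    Sym2.lift ⟨fun x y => c x y e.1.2, fun x y => h.symm x y _⟩ e.1.1.1
  have key : ∀ (e : E(completeMultigraph n l)) (x : V(completeMultigraph n l)),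
      (completeMultigraph n l).Inc e x →
      ∃ y, y ≠ x.1 ∧ e.1.1.1 = s(x.1, y) ∧ cE e = c x.1 y e.1.2 := by
    rintro e x ⟨y, hy⟩
    change e.1.1.1 = s(x.1, y) at hy
    refine ⟨y, ?_, hy, by simp [cE, hy]⟩
    rintro rfl
    exact e.1.1.2 (by simp [hy])
  have hprop : ∀ (e f : E(completeMultigraph n l)) (x : V(completeMultigraph n l)),
      (completeMultigraph n l).Inc e x → (completeMultigraph n l).Inc f x →
      cE e = cE f → e = f := by
    intro e f x he hf hef
    obtain ⟨y, hy, hey, hcy⟩ := key e x he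
    obtain ⟨z, hz, hez, hcz⟩ := key f x hf
    rw [hcy, hcz] at hef
    obtain ⟨rfl, hi⟩ := h.proper _ _ _ _ _ hy hz hef
    exact Subtype.ext (Prod.ext (Subtype.ext (hey.trans hez.symm)) hi)
  refine ⟨fun x => φ (v x.1), fun e => φ (cE e), ⟨⟨?_, ?_, ?_⟩, ?_⟩⟩
  · intro x y hxy _ hc
    exact hxy (Subtype.ext (h.injective (φ.injective hc)))
  · intro e f x hef he hf hc
    exact hef (hprop e f x he hf (φ.injective hc))
  · intro x e he hc
    obtain ⟨y, hy, -, hcy⟩ := key e x he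
    exact h.incident _ _ _ hy ((φ.injective hc).trans hcy)
  · intro x y e f he hf hc
    -- Equality without crossing reduces to properness at one vertex; only the crossed case needs
    -- `pair`.
    rcases Sym2.eq_iff.1 hc with ⟨h1, h2⟩ | ⟨h1, h2⟩
    · have hxy : x = y := Subtype.ext (h.injective (φ.injective h1))
      subst hxy
      exact ⟨rfl, hprop e f x he hf (φ.injective h2)⟩
    · obtain ⟨x', hx', -, hcx⟩ := key e x he
      obtain ⟨y', hy', -, hcy⟩ := key f y hf
      exact absurd ((φ.injective h2).symm.trans hcx)
        (h.pair _ _ _ _ _ _ hx' hy' ((φ.injective h1).trans hcy))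

/-! ### Layering: one harmonious copy and fresh proper copies -/

/-- `R c x y` says that the edge from `x` to `y` of the complete graph on `V` has colour `c`, where
the colours are the vertices and the elements of `X`; the conditions say that this is a
harmonious total colouring. -/
structure IsHarmoniousRelation {V X : Type*} (R : V ⊕ X → V → V → Prop) : Prop where
  cover : ∀ x y, x ≠ y → ∃ c, R c x y ∨ R c y x
  proper : ∀ c x y z, (R c x y ∨ R c y x) → (R c x z ∨ R c z x) → y = z
  irrefl : ∀ x y, ¬ (R (Sum.inl x) x y ∨ R (Sum.inl x) y x)
  asymm : ∀ x y z w, (R (Sum.inl z) x y ∨ R (Sum.inl z) y x) →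
    ¬ (R (Sum.inl x) z w ∨ R (Sum.inl x) w z)

/-- `g` restricts to a proper edge colouring of the complete graph on `V`. -/
structure IsProperEdgeFunction {V Y : Type*} (g : V → V → Y) : Prop where
  symm : ∀ x y, g x y = g y x
  inj : ∀ x y z, y ≠ x → z ≠ x → g x y = g x z → y = z

theorem IsProperEdgeFunction.comp_equiv {V W Y Z : Type*} {g : V → V → Y}
    (hg : IsProperEdgeFunction g) (e : W ≃ V) (f : Y ≃ Z) :
    IsProperEdgeFunction fun x y => f (g (e x) (e y)) where
  symm x y := by rw [hg.symm]
  inj x y z hy hz h := e.injective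
    (hg.inj _ _ _ (e.injective.ne hy) (e.injective.ne hz) (f.injective h))

/-- Choosing on unordered pairs makes the choice symmetric. Any choice will do, because the
remaining harmony conditions bind all of `R`. -/
theorem exists_symm_function {V C : Type*} {R : C → V → V → Prop}
    (h : ∀ x y, x ≠ y → ∃ c, R c x y ∨ R c y x) [Nonempty C] :
    ∃ f : V → V → C, (∀ x y, f x y = f y x) ∧
      ∀ x y, x ≠ y → R (f x y) x y ∨ R (f x y) y x := by
  have h' : ∀ e : Sym2 V, ∃ c, ∀ x y, x ≠ y → e = s(x, y) → R c x y ∨ R c y x := by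
    intro e
    induction e using Sym2.ind with
    | _ a b =>
      by_cases hab : a = b
      · refine ⟨Classical.arbitrary C, fun x y hxy he => ?_⟩
        rcases Sym2.eq_iff.1 he with ⟨rfl, rfl⟩ | ⟨rfl, rfl⟩
        · exact absurd hab hxy
        · exact absurd hab.symm hxy
      · obtain ⟨c, hc⟩ := h a b hab
        refine ⟨c, fun x y hxy he => ?_⟩
        rcases Sym2.eq_iff.1 he with ⟨rfl, rfl⟩ | ⟨rfl, rfl⟩
        · exact hc
        · exact hc.symm
  choose f hf using h'
  exact ⟨fun x y => f s(x, y), fun x y => congrArg f Sym2.eq_swap,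
    fun x y hxy => hf _ x y hxy rfl⟩

theorem IsHarmoniousRelation.colourable {V X Y : Type*} [Fintype V] [Fintype X] [Fintype Y]
    {R : V ⊕ X → V → V → Prop} (hR : IsHarmoniousRelation R) {g : V → V → Y}
    (hg : IsProperEdgeFunction g) {n l : ℕ} (hn : Fintype.card V = n) (hn0 : 0 < n) :
    HarmoniousTotalColourable (completeMultigraph n l)
      (n + Fintype.card X + (l - 1) * Fintype.card Y) := by
  have e : Fin n ≃ V := (Fintype.equivFinOfCardEq hn).symm
  have : Nonempty V := ⟨e ⟨0, hn0⟩⟩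
  obtain ⟨f, hfs, hf⟩ := exists_symm_function hR.cover
  have hcard : n + Fintype.card X + (l - 1) * Fintype.card Y =
      Fintype.card ((V ⊕ X) ⊕ (Fin (l - 1) × Y)) := by simp [hn]
  rw [hcard]
  refine harmoniousTotalColourable_of_functions (v := fun x => Sum.inl (Sum.inl (e x)))
    -- Fresh colours never occur on vertices and are distinct between labels, so harmony is at stake
    -- only for label 0.
    (c := fun x y i => if hi : i.1 = 0 then Sum.inl (f (e x) (e y)) else
      Sum.inr (⟨i.1 - 1, by omega⟩, g (e x) (e y))) ⟨?_, ?_, ?_, ?_, ?_⟩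
  · intro x y h
    simpa using h
  · intro x y i
    simp only [hfs (e x) (e y), hg.symm (e x) (e y)]
  · intro x y z i j hy hz h
    have hy' : e x ≠ e y := e.injective.ne hy.symm
    have hz' : e x ≠ e z := e.injective.ne hz.symm
    by_cases hi : i.1 = 0 <;> by_cases hj : j.1 = 0 <;> simp [hi, hj] at h
    · have h1 := hf _ _ hy'
      rw [h] at h1
      exact ⟨e.injective (hR.proper _ _ _ _ h1 (hf _ _ hz')), Fin.ext (hi.trans hj.symm)⟩
    · exact ⟨e.injective (hg.inj _ _ _ hy'.symm hz'.symm h.2), Fin.ext (by omega)⟩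
  · intro x y i hy h
    have hy' : e x ≠ e y := e.injective.ne hy.symm
    by_cases hi : i.1 = 0 <;> simp [hi] at h
    have h1 := hf _ _ hy'
    rw [← h] at h1
    exact hR.irrefl _ _ h1
  · intro x y z w i j hy hw h1 h2
    have hy' : e x ≠ e y := e.injective.ne hy.symm
    have hw' : e z ≠ e w := e.injective.ne hw.symm
    by_cases hi : i.1 = 0 <;> by_cases hj : j.1 = 0 <;> simp [hi, hj] at h1 h2
    have h3 := hf _ _ hy'
    have h4 := hf _ _ hw'
    rw [← h1] at h4
    rw [← h2] at h3
    exact hR.asymm _ _ _ _ h3 h4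

/-! ### Optimal proper edge colourings of complete graphs -/

/-- A complete graph of odd order `p` has a proper edge colouring with `p` colours. -/
theorem isProperEdgeFunction_add (p : ℕ) :
    IsProperEdgeFunction fun x y : ZMod p => x + y where
  symm := add_comm
  inj _ _ _ _ _ h := add_left_cancel h

/-- The round-robin edge colouring of the complete graph of order `p + 1`. -/
def roundRobin (p : ℕ) : Option (ZMod p) → Option (ZMod p) → ZMod p
  | some x, some y => x + y
  | some x, none => 2 * x
  | none, some y => 2 * y
  | none, none => 0

/-- The sums `x + y` with `y ≠ x` miss `2 * x` at `x`, which frees it for the edge to `none`.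
Doubling is injective for odd `p`, so these colours differ. -/
theorem isProperEdgeFunction_roundRobin {p : ℕ} (hp : Odd p) :
    IsProperEdgeFunction (roundRobin p) where
  symm x y := by cases x <;> cases y <;> simp [roundRobin, add_comm]
  inj x y z hy hz h := by
    have h2 : IsUnit (2 : ZMod p) := by
      have := (ZMod.isUnit_iff_coprime 2 p).2 (Nat.coprime_two_left.2 hp)
      simpa using this
    rcases x with _ | x <;> rcases y with _ | y <;> rcases z with _ | z <;>
      simp_all [roundRobin, two_mul]
    simp only [← two_mul] at h
    exact h2.mul_left_cancel h

theorem exists_isProperEdgeFunction (V : Type*) [Fintype V] {q : ℕ} (hq : Odd q)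
    (hV : Fintype.card V = q ∨ Fintype.card V = q + 1) :
    ∃ g : V → V → Fin q, IsProperEdgeFunction g := by
  have : NeZero q := ⟨hq.pos.ne'⟩
  have e : ZMod q ≃ Fin q := Fintype.equivFinOfCardEq (ZMod.card q)
  rcases hV with hV | hV
  · exact ⟨_, (isProperEdgeFunction_add q).comp_equiv
      (Fintype.equivOfCardEq (by simp [hV])) e⟩
  · exact ⟨_, (isProperEdgeFunction_roundRobin hq).comp_equiv
      (Fintype.equivOfCardEq (by simp [hV])) e⟩

/-! ### Harmonious colourings for orders 2 and 3 modulo 4 -/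

/-- Colour classes of the complete graph on two copies `a`, `b` of `Fin (2 * h + 1)`. The edges
inside a copy have extra colours; the colour `a i` has the edges from `a (i + x)` to `b (i - x)`
and `b i` has the edges from `a (i - x)` to `b (i + x)`, for `1 ≤ x ≤ h`. -/
inductive TwiceOddClass (h : ℕ) :
    (Fin (2 * h + 1) ⊕ Fin (2 * h + 1)) ⊕ Fin (2 * h + 1) →
    Fin (2 * h + 1) ⊕ Fin (2 * h + 1) → Fin (2 * h + 1) ⊕ Fin (2 * h + 1) → Prop
  | left (i j k : Fin (2 * h + 1)) (x : ℕ) (hx : 1 ≤ x ∧ x ≤ h)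
      (hj : j.1 = i + x ∨ j.1 + (2 * h + 1) = i + x)
      (hk : k.1 + x = i ∨ k.1 + x = i + (2 * h + 1)) :
      TwiceOddClass h (.inl (.inl i)) (.inl j) (.inr k)
  | right (i j k : Fin (2 * h + 1)) (x : ℕ) (hx : 1 ≤ x ∧ x ≤ h)
      (hj : j.1 + x = i ∨ j.1 + x = i + (2 * h + 1))
      (hk : k.1 = i + x ∨ k.1 + (2 * h + 1) = i + x) :
      TwiceOddClass h (.inl (.inr i)) (.inl j) (.inr k)
  | inLeft (c j k : Fin (2 * h + 1)) (hjk : j ≠ k)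
      (hc : j.1 + k = c ∨ j.1 + k = c + (2 * h + 1)) :
      TwiceOddClass h (.inr c) (.inl j) (.inl k)
  | inRight (c j k : Fin (2 * h + 1)) (hjk : j ≠ k)
      (hc : j.1 + k = c ∨ j.1 + k = c + (2 * h + 1)) :
      TwiceOddClass h (.inr c) (.inr j) (.inr k)
  | diag (c j : Fin (2 * h + 1)) (hc : j.1 + j = c ∨ j.1 + j = c + (2 * h + 1)) :
      TwiceOddClass h (.inr c) (.inl j) (.inr j)

theorem exists_add_eq_or {M : ℕ} (j k : Fin M) :
    ∃ c : Fin M, j.1 + k = c ∨ j.1 + k = c + M := by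
  by_cases hc : j.1 + k < M
  · exact ⟨⟨j.1 + k, hc⟩, .inl rfl⟩
  · exact ⟨⟨j.1 + k - M, by omega⟩, .inr (by simp only; omega)⟩

/-- Modulo the odd number `2 * h + 1` the midpoint `i` of `j` and `k` exists, and `j - i` is `x` or
`-x` with `1 ≤ x ≤ h`. If `j + k` is odd, shifting it by the modulus makes it even and swaps the two
orientations. -/
theorem exists_midpoint {h : ℕ} {j k : Fin (2 * h + 1)} (hjk : j ≠ k) :
    ∃ (i : Fin (2 * h + 1)) (x : ℕ), (1 ≤ x ∧ x ≤ h) ∧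
      (((j.1 = i + x ∨ j.1 + (2 * h + 1) = i + x) ∧
          (k.1 + x = i ∨ k.1 + x = i + (2 * h + 1))) ∨
        ((j.1 + x = i ∨ j.1 + x = i + (2 * h + 1)) ∧
          (k.1 = i + x ∨ k.1 + (2 * h + 1) = i + x))) := by
  have hjk : j.1 ≠ k.1 := fun e => hjk (Fin.ext e)
  have hj := j.2
  have hk := k.2
  by_cases hp : (j.1 + k) % 2 = 0
  · by_cases hlt : k.1 < j
    · exact ⟨⟨(j.1 + k) / 2, by omega⟩, (j.1 - k) / 2, by omega, .inl (by simp only; omega)⟩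
    · exact ⟨⟨(j.1 + k) / 2, by omega⟩, (k.1 - j) / 2, by omega, .inr (by simp only; omega)⟩
  · by_cases hs : j.1 + k < 2 * h + 1
    · by_cases hlt : k.1 < j
      · exact ⟨⟨(j.1 + k + (2 * h + 1)) / 2, by omega⟩, (k.1 + (2 * h + 1) - j) / 2, by omega,
          .inr (by simp only; omega)⟩
      · exact ⟨⟨(j.1 + k + (2 * h + 1)) / 2, by omega⟩, (j.1 + (2 * h + 1) - k) / 2, by omega,
          .inl (by simp only; omega)⟩
    · by_cases hlt : k.1 < j
      · exact ⟨⟨(j.1 + k - (2 * h + 1)) / 2, by omega⟩, (k.1 + (2 * h + 1) - j) / 2, by omega,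
          .inr (by simp only; omega)⟩
      · exact ⟨⟨(j.1 + k - (2 * h + 1)) / 2, by omega⟩, (j.1 + (2 * h + 1) - k) / 2, by omega,
          .inl (by simp only; omega)⟩

/-- Opposite arcs would force a sum of two numbers from `1` to `h` to vanish modulo `2 * h + 1`.
Colour `2 * j` is missing at `j` inside each copy, so it is free for the edge from `a j` to `b j`.
-/
theorem isHarmoniousRelation_twiceOdd (h : ℕ) : IsHarmoniousRelation (TwiceOddClass h) where
  cover x y hxy := by
    have key : ∀ j k : Fin (2 * h + 1), ∃ c, TwiceOddClass h c (.inl j) (.inr k) := by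
      intro j k
      by_cases hjk : j = k
      · subst hjk
        obtain ⟨c, hc⟩ := exists_add_eq_or j j
        exact ⟨_, .diag c j hc⟩
      · obtain ⟨i, x, hx, ⟨h1, h2⟩ | ⟨h1, h2⟩⟩ := exists_midpoint hjk
        · exact ⟨_, .left i j k x hx h1 h2⟩
        · exact ⟨_, .right i j k x hx h1 h2⟩
    rcases x with j | j <;> rcases y with k | k
    · obtain ⟨c, hc⟩ := exists_add_eq_or j k
      exact ⟨_, .inl (.inLeft c j k (fun e => hxy (by rw [e])) hc)⟩
    · obtain ⟨c, hc⟩ := key j k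
      exact ⟨c, .inl hc⟩
    · obtain ⟨c, hc⟩ := key k j
      exact ⟨c, .inr hc⟩
    · obtain ⟨c, hc⟩ := exists_add_eq_or j k
      exact ⟨_, .inl (.inRight c j k (fun e => hxy (by rw [e])) hc)⟩
  proper c x y z h1 h2 := by
    rcases h1 with h1 | h1 <;> rcases h2 with h2 | h2 <;> cases h1 <;> cases h2 <;>
      simp only [ne_eq, Sum.inl.injEq, Sum.inr.injEq, Fin.ext_iff, reduceCtorEq] at * <;> omega
  irrefl x y h1 := by
    rcases h1 with h1 | h1 <;> cases h1 <;> omega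
  asymm x y z w h1 h2 := by
    rcases h1 with h1 | h1 <;> rcases h2 with h2 | h2 <;> cases h1 <;> cases h2 <;> omega

/-- The variant of `TwiceOddClass` with one further vertex, `none`, and one further colour. -/
inductive TwiceOddSuccClass (h : ℕ) :
    Option (Fin (2 * h + 1) ⊕ Fin (2 * h + 1)) ⊕ Option (Fin (2 * h + 1)) →
    Option (Fin (2 * h + 1) ⊕ Fin (2 * h + 1)) → Option (Fin (2 * h + 1) ⊕ Fin (2 * h + 1)) → Prop
  | left (i j k : Fin (2 * h + 1)) (x : ℕ) (hx : 1 ≤ x ∧ x ≤ h)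
      (hj : j.1 = i + x ∨ j.1 + (2 * h + 1) = i + x)
      (hk : k.1 + x = i ∨ k.1 + x = i + (2 * h + 1)) :
      TwiceOddSuccClass h (.inl (some (.inl i))) (some (.inl j)) (some (.inr k))
  | right (i j k : Fin (2 * h + 1)) (x : ℕ) (hx : 1 ≤ x ∧ x ≤ h)
      (hj : j.1 + x = i ∨ j.1 + x = i + (2 * h + 1))
      (hk : k.1 = i + x ∨ k.1 + (2 * h + 1) = i + x) :
      TwiceOddSuccClass h (.inl (some (.inr i))) (some (.inl j)) (some (.inr k))
  | inLeft (c j k : Fin (2 * h + 1)) (hjk : j ≠ k)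
      (hc : j.1 + k = c ∨ j.1 + k = c + (2 * h + 1)) :
      TwiceOddSuccClass h (.inr (some c)) (some (.inl j)) (some (.inl k))
  | inRight (c j k : Fin (2 * h + 1)) (hjk : j ≠ k)
      (hc : j.1 + k = c ∨ j.1 + k = c + (2 * h + 1)) :
      TwiceOddSuccClass h (.inr (some c)) (some (.inr j)) (some (.inr k))
  | diag (j : Fin (2 * h + 1)) :
      TwiceOddSuccClass h (.inr none) (some (.inl j)) (some (.inr j))
  | noneLeft (c j : Fin (2 * h + 1)) (hc : j.1 + j = c ∨ j.1 + j = c + (2 * h + 1)) :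
      TwiceOddSuccClass h (.inr (some c)) none (some (.inl j))
  | noneRight (j : Fin (2 * h + 1)) :
      TwiceOddSuccClass h (.inl (some (.inl j))) none (some (.inr j))

/-- The new vertex takes over the colours `2 * j` at `a j`, pushing the diagonal edges to the new
colour. Its edge to `b j` can have colour `a j`, since the pair `a j`, `b j` carries no arc yet and
the colour of `none` is unused. -/
theorem isHarmoniousRelation_twiceOddSucc (h : ℕ) :
    IsHarmoniousRelation (TwiceOddSuccClass h) where
  cover x y hxy := by
    have key : ∀ j k : Fin (2 * h + 1),
        ∃ c, TwiceOddSuccClass h c (some (.inl j)) (some (.inr k)) := by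
      intro j k
      by_cases hjk : j = k
      · subst hjk
        exact ⟨_, .diag j⟩
      · obtain ⟨i, x, hx, ⟨h1, h2⟩ | ⟨h1, h2⟩⟩ := exists_midpoint hjk
        · exact ⟨_, .left i j k x hx h1 h2⟩
        · exact ⟨_, .right i j k x hx h1 h2⟩
    have key' : ∀ j : Fin (2 * h + 1), ∃ c, TwiceOddSuccClass h c none (some (.inl j)) := by
      intro j
      obtain ⟨c, hc⟩ := exists_add_eq_or j j
      exact ⟨_, .noneLeft c j hc⟩
    rcases x with _ | j | j <;> rcases y with _ | k | k
    · exact absurd rfl hxy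
    · exact (key' k).imp fun _ => .inl
    · exact ⟨_, .inl (.noneRight k)⟩
    · exact (key' j).imp fun _ => .inr
    · obtain ⟨c, hc⟩ := exists_add_eq_or j k
      exact ⟨_, .inl (.inLeft c j k (fun e => hxy (by rw [e])) hc)⟩
    · exact (key j k).imp fun _ => .inl
    · exact ⟨_, .inr (.noneRight j)⟩
    · exact (key k j).imp fun _ => .inr
    · obtain ⟨c, hc⟩ := exists_add_eq_or j k
      exact ⟨_, .inl (.inRight c j k (fun e => hxy (by rw [e])) hc)⟩
  proper c x y z h1 h2 := by
    rcases h1 with h1 | h1 <;> rcases h2 with h2 | h2 <;> cases h1 <;> cases h2 <;>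
      simp only [ne_eq, Option.some.injEq, Sum.inl.injEq, Sum.inr.injEq, Fin.ext_iff,
        reduceCtorEq] at * <;> omega
  irrefl x y h1 := by
    rcases h1 with h1 | h1 <;> cases h1 <;> omega
  asymm x y z w h1 h2 := by
    rcases h1 with h1 | h1 <;> rcases h2 with h2 | h2 <;> cases h1 <;> cases h2 <;> omega

/-! ### Harmonious colourings for orders 1 and 0 modulo 4 -/

/-- The colour classes for `4 * N + 1` vertices: two copies `a`, `b` of `Fin (2 * N)` and the
vertex `none`. -/
inductive FourMulSuccClass (N : ℕ) :
    Option (Fin (2 * N) ⊕ Fin (2 * N)) ⊕ Option (Fin (2 * N)) →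
    Option (Fin (2 * N) ⊕ Fin (2 * N)) → Option (Fin (2 * N) ⊕ Fin (2 * N)) → Prop
  | left (i j k : Fin (2 * N)) (x : ℕ) (hx : 1 ≤ x ∧ x < N)
      (hj : j.1 = i + x ∨ j.1 + 2 * N = i + x)
      (hk : k.1 + x = i + 1 ∨ k.1 + x = i + 1 + 2 * N) :
      FourMulSuccClass N (.inl (some (.inl i))) (some (.inl j)) (some (.inr k))
  | right (i j k : Fin (2 * N)) (x : ℕ) (hx : 1 ≤ x ∧ x < N)
      (hj : j.1 + x = i ∨ j.1 + x = i + 2 * N)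
      (hk : k.1 = i + x ∨ k.1 + 2 * N = i + x) :
      FourMulSuccClass N (.inl (some (.inr i))) (some (.inl j)) (some (.inr k))
  | inLeft (c j k : Fin (2 * N)) (hjk : j ≠ k) (hc : j.1 + k = c ∨ j.1 + k = c + 2 * N) :
      FourMulSuccClass N (.inr (some c)) (some (.inl j)) (some (.inl k))
  | inRight (c j k : Fin (2 * N)) (hjk : j ≠ k) (hc : j.1 + k = c ∨ j.1 + k = c + 2 * N) :
      FourMulSuccClass N (.inr (some c)) (some (.inr j)) (some (.inr k))
  | diagLow (i j : Fin (2 * N)) (hi : i.1 = j + N) :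
      FourMulSuccClass N (.inl (some (.inr i))) (some (.inl j)) (some (.inr j))
  | diagHigh (c j : Fin (2 * N)) (hj : N ≤ j.1) (hc : j.1 + j = c + 2 * N) :
      FourMulSuccClass N (.inr (some c)) (some (.inl j)) (some (.inr j))
  | shift (j k : Fin (2 * N)) (hk : k.1 = j + 1 ∨ k.1 + 2 * N = j + 1) :
      FourMulSuccClass N (.inr none) (some (.inl j)) (some (.inr k))
  | noneRight (i k : Fin (2 * N)) (hi : i.1 + 1 = k + N ∨ i.1 + 1 + 2 * N = k + N) :
      FourMulSuccClass N (.inl (some (.inl i))) none (some (.inr k))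
  | noneLow (c j : Fin (2 * N)) (hj : j.1 < N) (hc : c.1 = j + j) :
      FourMulSuccClass N (.inr (some c)) none (some (.inl j))
  | noneHigh (i j : Fin (2 * N)) (hi : j.1 = i + N) :
      FourMulSuccClass N (.inl (some (.inr i))) none (some (.inl j))

/-- Modulo `2 * N`, the second alternative realises the differences `k - j = 2 * x` and the first `1
- 2 * x`. For `1 ≤ x < N` these are all residues except 0 and 1, hence the two exclusions. -/
theorem exists_shifted_midpoint {N : ℕ} {j k : Fin (2 * N)} (hjk : j ≠ k)
    (hjk' : ¬ (k.1 = j + 1 ∨ k.1 + 2 * N = j + 1)) :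
    ∃ (i : Fin (2 * N)) (x : ℕ), (1 ≤ x ∧ x < N) ∧
      (((j.1 = i + x ∨ j.1 + 2 * N = i + x) ∧
          (k.1 + x = i + 1 ∨ k.1 + x = i + 1 + 2 * N)) ∨
        ((j.1 + x = i ∨ j.1 + x = i + 2 * N) ∧
          (k.1 = i + x ∨ k.1 + 2 * N = i + x))) := by
  have hjk : j.1 ≠ k.1 := fun e => hjk (Fin.ext e)
  have hj := j.2
  have hk := k.2
  obtain ⟨d, hd, hd'⟩ : ∃ d, d < 2 * N ∧ (k.1 = j + d ∨ k.1 + 2 * N = j + d) := by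
    by_cases hlt : j.1 < k
    · exact ⟨k - j, by omega, by omega⟩
    · exact ⟨k + 2 * N - j, by omega, by omega⟩
  by_cases hp : d % 2 = 0
  · by_cases hs : j.1 + d / 2 < 2 * N
    · exact ⟨⟨j.1 + d / 2, hs⟩, d / 2, by omega, .inr ⟨.inl rfl, by simp only; omega⟩⟩
    · exact ⟨⟨j.1 + d / 2 - 2 * N, by omega⟩, d / 2, by omega, .inr (by simp only; omega)⟩
  · by_cases hs : N - d / 2 ≤ j.1
    · exact ⟨⟨j.1 - (N - d / 2), by omega⟩, N - d / 2, by omega, .inl (by simp only; omega)⟩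
    · exact ⟨⟨j.1 + 2 * N - (N - d / 2), by omega⟩, N - d / 2, by omega,
        .inl (by simp only; omega)⟩

/-- Inside the two copies, `left` and `right` leave without arcs only the antipodal pairs of each
copy and the pairs of `a i` with `b (i + N)` and `b (i + N + 1)`. The other classes with vertex
colours use such pairs and arcs to `none`. An even colour `c` is missing at both solutions of `2 * j
= c` in each copy, which makes room for `diagHigh` and `noneLow`. -/
theorem isHarmoniousRelation_fourMulSucc (N : ℕ) :
    IsHarmoniousRelation (FourMulSuccClass N) where
  cover x y hxy := by
    have key : ∀ j k : Fin (2 * N),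
        ∃ c, FourMulSuccClass N c (some (.inl j)) (some (.inr k)) := by
      intro j k
      have hj := j.2
      by_cases hjk : j = k
      · subst hjk
        by_cases hjN : j.1 < N
        · exact ⟨_, .diagLow ⟨j.1 + N, by omega⟩ j rfl⟩
        · exact ⟨_, .diagHigh ⟨j.1 + j - 2 * N, by omega⟩ j (by omega) (by simp only; omega)⟩
      · by_cases hk : k.1 = j + 1 ∨ k.1 + 2 * N = j + 1
        · exact ⟨_, .shift j k hk⟩
        · obtain ⟨i, x, hx, ⟨h1, h2⟩ | ⟨h1, h2⟩⟩ := exists_shifted_midpoint hjk hk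
          · exact ⟨_, .left i j k x hx h1 h2⟩
          · exact ⟨_, .right i j k x hx h1 h2⟩
    have keyLeft : ∀ j : Fin (2 * N), ∃ c, FourMulSuccClass N c none (some (.inl j)) := by
      intro j
      have hj := j.2
      by_cases hjN : j.1 < N
      · exact ⟨_, .noneLow ⟨j.1 + j, by omega⟩ j hjN rfl⟩
      · exact ⟨_, .noneHigh ⟨j.1 - N, by omega⟩ j (by simp only; omega)⟩
    have keyRight : ∀ j : Fin (2 * N), ∃ c, FourMulSuccClass N c none (some (.inr j)) := by
      intro k
      have hk := k.2
      by_cases hkN : k.1 ≤ N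
      · exact ⟨_, .noneRight ⟨k.1 + N - 1, by omega⟩ k (by simp only; omega)⟩
      · exact ⟨_, .noneRight ⟨k.1 + N - 1 - 2 * N, by omega⟩ k (by simp only; omega)⟩
    rcases x with _ | j | j <;> rcases y with _ | k | k
    · exact absurd rfl hxy
    · exact (keyLeft k).imp fun _ => .inl
    · exact (keyRight k).imp fun _ => .inl
    · exact (keyLeft j).imp fun _ => .inr
    · obtain ⟨c, hc⟩ := exists_add_eq_or j k
      exact ⟨_, .inl (.inLeft c j k (fun e => hxy (by rw [e])) hc)⟩
    · exact (key j k).imp fun _ => .inl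
    · exact (keyRight j).imp fun _ => .inr
    · exact (key k j).imp fun _ => .inr
    · obtain ⟨c, hc⟩ := exists_add_eq_or j k
      exact ⟨_, .inl (.inRight c j k (fun e => hxy (by rw [e])) hc)⟩
  proper c x y z h1 h2 := by
    rcases h1 with h1 | h1 <;> rcases h2 with h2 | h2 <;> cases h1 <;> cases h2 <;>
      simp only [ne_eq, Option.some.injEq, Sum.inl.injEq, Sum.inr.injEq, Fin.ext_iff,
        reduceCtorEq] at * <;> omega
  irrefl x y h1 := by
    rcases h1 with h1 | h1 <;> cases h1 <;> omega
  asymm x y z w h1 h2 := by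
    rcases h1 with h1 | h1 <;> rcases h2 with h2 | h2 <;> cases h1 <;> cases h2 <;> omega

/-- The colour classes for `4 * N` vertices, in two copies `a`, `b` of `Fin (2 * N)`, where `g` is
a proper edge colouring of the complete graph on `Fin (2 * N)`: from the edges coloured by `g` the
edges joining `N - 2` and `N - 1` are removed, and their colour is used for two edges
from `a` to `b`. -/
inductive FourMulClass (N : ℕ) (g : Fin (2 * N) → Fin (2 * N) → Fin (2 * N - 1)) :
    (Fin (2 * N) ⊕ Fin (2 * N)) ⊕ Option (Fin (2 * N - 1)) →
    Fin (2 * N) ⊕ Fin (2 * N) → Fin (2 * N) ⊕ Fin (2 * N) → Prop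
  | left (i j k : Fin (2 * N)) (x : ℕ) (hx : 1 ≤ x ∧ x < N)
      (hj : j.1 = i + x ∨ j.1 + 2 * N = i + x)
      (hk : k.1 + x = i + 1 ∨ k.1 + x = i + 1 + 2 * N) :
      FourMulClass N g (.inl (.inl i)) (.inl j) (.inr k)
  | right (i j k : Fin (2 * N)) (x : ℕ) (hx : 1 ≤ x ∧ x < N)
      (hj : j.1 + x = i ∨ j.1 + x = i + 2 * N)
      (hk : k.1 = i + x ∨ k.1 + 2 * N = i + x) :
      FourMulClass N g (.inl (.inr i)) (.inl j) (.inr k)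
  | inLeft (c : Fin (2 * N - 1)) (j k : Fin (2 * N)) (hjk : j ≠ k)
      (h1 : ¬ (j.1 + 2 = N ∧ k.1 + 1 = N)) (h2 : ¬ (k.1 + 2 = N ∧ j.1 + 1 = N))
      (hc : g j k = c) : FourMulClass N g (.inr (some c)) (.inl j) (.inl k)
  | inRight (c : Fin (2 * N - 1)) (j k : Fin (2 * N)) (hjk : j ≠ k)
      (h1 : ¬ (j.1 + 2 = N ∧ k.1 + 1 = N)) (h2 : ¬ (k.1 + 2 = N ∧ j.1 + 1 = N))
      (hc : g j k = c) : FourMulClass N g (.inr (some c)) (.inr j) (.inr k)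
  | removedLeft (i j k : Fin (2 * N)) (hi : i.1 + 1 = 2 * N) (hj : j.1 + 2 = N)
      (hk : k.1 + 1 = N) : FourMulClass N g (.inl (.inr i)) (.inl j) (.inl k)
  | removedRight (j k : Fin (2 * N)) (hj : j.1 + 2 = N) (hk : k.1 + 1 = N) :
      FourMulClass N g (.inr none) (.inr j) (.inr k)
  | diagMid (c : Fin (2 * N - 1)) (p q j : Fin (2 * N)) (hp : p.1 + 2 = N) (hq : q.1 + 1 = N)
      (hj : j = p ∨ j = q) (hc : g p q = c) :
      FourMulClass N g (.inr (some c)) (.inl j) (.inr j)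
  | diagLow (j : Fin (2 * N)) (hj : j.1 + 3 ≤ N) :
      FourMulClass N g (.inr none) (.inl j) (.inr j)
  | diagHigh (i j : Fin (2 * N)) (hj : j.1 = i + N) :
      FourMulClass N g (.inl (.inr i)) (.inl j) (.inr j)
  | shiftLow (i j k : Fin (2 * N)) (hk : k.1 = j + 1 ∨ k.1 + 2 * N = j + 1) (hkN : k.1 < N)
      (hi : i.1 + 1 = k + N) : FourMulClass N g (.inl (.inl i)) (.inl j) (.inr k)
  | shiftHigh (j k : Fin (2 * N)) (hk : k.1 = j + 1) (hkN : N ≤ k.1) :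
      FourMulClass N g (.inr none) (.inl j) (.inr k)

/-- The same pairs are free of arcs as for `4 * N + 1` vertices. `diagHigh`, `shiftLow` and
`removedLeft` use them, each in one direction. The remaining diagonal and shifted edges do not form
a matching: those at `a` and `b` of `N - 2` and `N - 1` are the obstacle. Exchanging the two
diagonal edges there for the two removed edges repairs this. -/
theorem isHarmoniousRelation_fourMul {N : ℕ} (hN : 2 ≤ N)
    {g : Fin (2 * N) → Fin (2 * N) → Fin (2 * N - 1)} (hg : IsProperEdgeFunction g) :
    IsHarmoniousRelation (FourMulClass N g) where
  cover x y hxy := by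
    have key : ∀ j k : Fin (2 * N), ∃ c, FourMulClass N g c (.inl j) (.inr k) := by
      intro j k
      have hj := j.2
      have hk := k.2
      by_cases hjk : j = k
      · subst hjk
        by_cases h1 : j.1 + 3 ≤ N
        · exact ⟨_, .diagLow j h1⟩
        · by_cases h2 : j.1 < N
          · refine ⟨_, .diagMid _ ⟨N - 2, by omega⟩ ⟨N - 1, by omega⟩ j (by simp only; omega)
              (by simp only; omega) ?_ rfl⟩
            simp only [Fin.ext_iff]
            omega
          · exact ⟨_, .diagHigh ⟨j.1 - N, by omega⟩ j (by simp only; omega)⟩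
      · by_cases hk' : k.1 = j + 1 ∨ k.1 + 2 * N = j + 1
        · by_cases hkN : k.1 < N
          · exact ⟨_, .shiftLow ⟨k.1 + N - 1, by omega⟩ j k hk' hkN (by simp only; omega)⟩
          · exact ⟨_, .shiftHigh j k (by omega) (by omega)⟩
        · obtain ⟨i, x, hx, ⟨h1, h2⟩ | ⟨h1, h2⟩⟩ := exists_shifted_midpoint hjk hk'
          · exact ⟨_, .left i j k x hx h1 h2⟩
          · exact ⟨_, .right i j k x hx h1 h2⟩
    rcases x with j | j <;> rcases y with k | k
    · by_cases h1 : j.1 + 2 = N ∧ k.1 + 1 = N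
      · exact ⟨_, .inl (.removedLeft ⟨2 * N - 1, by omega⟩ j k (by simp only; omega) h1.1 h1.2)⟩
      · by_cases h2 : k.1 + 2 = N ∧ j.1 + 1 = N
        · exact ⟨_, .inr (.removedLeft ⟨2 * N - 1, by omega⟩ k j (by simp only; omega) h2.1 h2.2)⟩
        · exact ⟨_, .inl (.inLeft _ j k (fun e => hxy (by rw [e])) h1 h2 rfl)⟩
    · exact (key j k).imp fun _ => .inl
    · exact (key k j).imp fun _ => .inr
    · by_cases h1 : j.1 + 2 = N ∧ k.1 + 1 = N
      · exact ⟨_, .inl (.removedRight j k h1.1 h1.2)⟩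
      · by_cases h2 : k.1 + 2 = N ∧ j.1 + 1 = N
        · exact ⟨_, .inr (.removedRight k j h2.1 h2.2)⟩
        · exact ⟨_, .inl (.inRight _ j k (fun e => hxy (by rw [e])) h1 h2 rfl)⟩
  proper c x y z h1 h2 := by
    have hs := hg.symm
    have hi : ∀ x y z : Fin (2 * N), y ≠ x → z ≠ x → g x y = g x z → y = z := hg.inj
    rcases h1 with h1 | h1 <;> rcases h2 with h2 | h2 <;> cases h1 <;> cases h2 <;>
      -- Arithmetic settles all cases except those comparing two values of `g`, which need its
      -- injectivity and symmetry.
      first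
      | (simp only [ne_eq, Sum.inl.injEq, Sum.inr.injEq, Fin.ext_iff, reduceCtorEq] at * <;> omega)
      | grind
  irrefl x y h1 := by
    rcases h1 with h1 | h1 <;> cases h1 <;> omega
  asymm x y z w h1 h2 := by
    rcases h1 with h1 | h1 <;> rcases h2 with h2 | h2 <;> cases h1 <;> cases h2 <;> omega

/-! ### From colourings of the multigraph back to functions -/

theorem HarmoniousTotalColourable.exists_functions {n l k : ℕ} (hl : 1 ≤ l)
    (h : HarmoniousTotalColourable (completeMultigraph n l) k) :
    ∃ (v : Fin n → Fin k) (c : Fin n → Fin n → Fin l → Fin k), IsHarmoniousFunctions v c := by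
  obtain ⟨cV, cE, hc⟩ := h
  let G := completeMultigraph n l
  let vx : Fin n → V(G) := fun x => ⟨x, Set.mem_univ x⟩
  let ed : ∀ x y : Fin n, y ≠ x → Fin l → E(G) := fun x y hxy i =>
    ⟨(⟨s(x, y), fun hd => hxy (Sym2.mk_isDiag_iff.1 hd).symm⟩, i), Set.mem_univ _⟩
  have hsymm : ∀ x y hxy i, ed x y hxy i = ed y x hxy.symm i := fun x y hxy i =>
    Subtype.ext (Prod.ext (Subtype.ext Sym2.eq_swap) rfl)
  have hinc : ∀ x y hxy i, G.Inc (ed x y hxy i) (vx x) := fun x y hxy i => ⟨y, rfl⟩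
  have hinj : ∀ x y z hy hz i j, ed x y hy i = ed x z hz j → y = z ∧ i = j := by
    intro x y z hy hz i j he
    have h1 : s(x, y) = s(x, z) := congrArg (fun e : E(G) => e.1.1.1) he
    exact ⟨Sym2.congr_right.1 h1, congrArg (fun e : E(G) => e.1.2) he⟩
  -- The value for `y = x` is a dummy: all conditions but symmetry exclude that case.
  refine ⟨fun x => cV (vx x), fun x y i => if hxy : y ≠ x then cE (ed x y hxy i) else cV (vx x),
    ?_, ?_, ?_, ?_, ?_⟩
  · intro x y hxy
    by_contra hne
    exact hc.vertex_ne (vx x) (vx y) (fun e => hne (congrArg Subtype.val e))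
      ⟨(⟨s(x, y), fun hd => hne (Sym2.mk_isDiag_iff.1 hd)⟩, ⟨0, hl⟩), rfl⟩ hxy
  · intro x y i
    by_cases hxy : y = x
    · subst hxy
      rfl
    · simp only [ne_eq, hxy, Ne.symm hxy, not_false_eq_true, dite_true]
      rw [hsymm]
  · intro x y z i j hy hz he
    simp only [hy, hz, ne_eq, not_false_eq_true, dite_true] at he
    by_contra hne
    exact hc.edge_ne _ _ (vx x) (fun e => hne (hinj _ _ _ _ _ _ _ e)) (hinc x y hy i)
      (hinc x z hz j) he
  · intro x y i hy he
    simp only [hy, ne_eq, not_false_eq_true, dite_true] at he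
    exact hc.incident_ne _ _ (hinc x y hy i) he
  · intro x y z w i j hy hw h1 h2
    simp only [hy, hw, ne_eq, not_false_eq_true, dite_true] at h1 h2
    have h3 := hc.pair_unique (vx x) (vx z) _ _ (hinc x y hy i) (hinc z w hw j)
      (by rw [h1, ← h2, Sym2.eq_swap])
    have h4 : x = z := congrArg Subtype.val h3.1
    subst h4
    exact hc.incident_ne _ _ (hinc x w hw j) h1

theorem Finset.even_card_of_involution {α : Type*} (s : Finset α) (f : α → α)
    (hf : ∀ a ∈ s, f a ∈ s) (hff : ∀ a ∈ s, f (f a) = a) (hne : ∀ a ∈ s, f a ≠ a) :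
    Even s.card := by
  have h : ∑ _a ∈ s, (1 : ZMod 2) = 0 :=
    Finset.sum_involution (fun a _ => f a) (fun _ _ => by decide) (fun a ha _ => hne a ha)
      hf hff
  rw [Finset.sum_const, nsmul_eq_mul, mul_one] at h
  exact (ZMod.natCast_eq_zero_iff_even).1 h

/-! ### The counting lower bound -/

section Counting

variable {n l k : ℕ} {v : Fin n → Fin k} {c : Fin n → Fin n → Fin l → Fin k}

/-- A vertex `x` with an edge coloured `v z` is sent to the pair of `x` and `z`. This is injective:
the same orientation is excluded by properness, the opposite one by `pair`. -/
theorem IsHarmoniousFunctions.card_vertexColoured_le (h : IsHarmoniousFunctions v c) :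
    ((Finset.univ : Finset (Fin n × Fin n × Fin l)).filter
      fun t => t.2.1 ≠ t.1 ∧ ∃ z, v z = c t.1 t.2.1 t.2.2).card ≤ n.choose 2 := by
  classical
  have hcard : n.choose 2 =
      ((Finset.univ : Finset (Sym2 (Fin n))).filter fun e => ¬ e.IsDiag).card := by
    rw [← Fintype.card_subtype, Sym2.card_subtype_not_diag, Fintype.card_fin]
  rw [hcard]
  have hz : ∀ t : Fin n × Fin n × Fin l, ∃ z,
      (∃ z, v z = c t.1 t.2.1 t.2.2) → v z = c t.1 t.2.1 t.2.2 := by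
    intro t
    by_cases ht : ∃ z, v z = c t.1 t.2.1 t.2.2
    · exact ht.imp fun z hz _ => hz
    · exact ⟨t.1, fun h => absurd h ht⟩
  choose f hf using hz
  refine Finset.card_le_card_of_injOn (fun t => s(t.1, f t)) ?_ ?_
  · rintro ⟨x, y, i⟩ ht
    simp only [Finset.coe_filter, Finset.mem_univ, true_and, Set.mem_ofPred_eq] at ht ⊢
    intro hd
    have hd : x = f (x, y, i) := Sym2.mk_isDiag_iff.1 hd
    have := hf (x, y, i) ht.2
    rw [← hd] at this
    exact h.incident _ _ _ ht.1 this
  · rintro ⟨x, y, i⟩ ht ⟨x', y', i'⟩ ht' he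
    simp only [Finset.coe_filter, Finset.mem_univ, true_and, Set.mem_ofPred_eq] at ht ht'
    have h1 := hf (x, y, i) ht.2
    have h2 := hf (x', y', i') ht'.2
    rcases Sym2.eq_iff.1 he with ⟨e1, e2⟩ | ⟨e1, e2⟩
    · simp only at e1
      subst e1
      rw [e2] at h1
      obtain ⟨rfl, rfl⟩ := h.proper _ _ _ _ _ ht.1 ht'.1 (h1.symm.trans h2)
      rfl
    · simp only at e1 e2
      rw [e2] at h1
      rw [← e1] at h2
      exact absurd h1 (h.pair _ _ _ _ _ _ ht.1 ht'.1 h2)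

/-- A colour class is a matching: each vertex starts at most one of its oriented edges, and reversal
pairs these up. -/
theorem IsHarmoniousFunctions.card_colour_le (h : IsHarmoniousFunctions v c) (d : Fin k) :
    ((Finset.univ : Finset (Fin n × Fin n × Fin l)).filter
      fun t => t.2.1 ≠ t.1 ∧ c t.1 t.2.1 t.2.2 = d).card ≤ 2 * (n / 2) := by
  classical
  set s := (Finset.univ : Finset (Fin n × Fin n × Fin l)).filter
      fun t => t.2.1 ≠ t.1 ∧ c t.1 t.2.1 t.2.2 = d with hs
  have h1 : Even s.card := by
    refine Finset.even_card_of_involution s (fun t => (t.2.1, t.1, t.2.2)) ?_ ?_ ?_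
    · rintro ⟨x, y, i⟩ ht
      simp only [hs, Finset.mem_filter, Finset.mem_univ, true_and] at ht ⊢
      exact ⟨ht.1.symm, by rw [h.symm, ht.2]⟩
    · rintro ⟨x, y, i⟩ _
      rfl
    · rintro ⟨x, y, i⟩ ht he
      simp only [hs, Finset.mem_filter, Finset.mem_univ, true_and] at ht
      exact ht.1 (congrArg Prod.fst he)
  have h2 : s.card ≤ n := by
    refine (Finset.card_le_card_of_injOn (t := Finset.univ) (fun t => t.1)
      (fun _ _ => Finset.mem_coe.2 (Finset.mem_univ _)) ?_).trans_eq (Finset.card_fin n)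
    rintro ⟨x, y, i⟩ ht ⟨x', y', i'⟩ ht' he
    simp only [hs, Finset.coe_filter, Finset.mem_univ, true_and, Set.mem_ofPred_eq] at ht ht' he
    subst he
    obtain ⟨rfl, rfl⟩ := h.proper _ _ _ _ _ ht.1 ht'.1 (ht.2.trans ht'.2.symm)
    rfl
  obtain ⟨r, hr⟩ := h1
  omega

theorem card_ordered_pairs (n l : ℕ) :
    ((Finset.univ : Finset (Fin n × Fin n × Fin l)).filter fun t => t.2.1 ≠ t.1).card =
      n * (n - 1) * l := by
  classical
  have e : ((Finset.univ : Finset (Fin n × Fin n × Fin l)).filter fun t => t.2.1 ≠ t.1) =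
      ((Finset.univ : Finset (Fin n)).offDiag ×ˢ (Finset.univ : Finset (Fin l))).map
        (Equiv.prodAssoc _ _ _).toEmbedding := by
    ext ⟨x, y, i⟩
    simp [eq_comm]
  rw [e, Finset.card_map, Finset.card_product, Finset.offDiag_card, Finset.card_fin,
    Finset.card_fin, Nat.mul_sub, mul_one]

theorem card_compl_image (hv : Function.Injective v) :
    ((Finset.univ : Finset (Fin k)).filter fun d => ∀ z, v z ≠ d).card = k - n := by
  classical
  have e : ((Finset.univ : Finset (Fin k)).filter fun d => ∀ z, v z ≠ d) =
      (Finset.univ.image v)ᶜ := by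
    ext d
    simp
  rw [e, Finset.card_compl, Finset.card_image_of_injective _ hv, Finset.card_fin, Fintype.card_fin]

theorem IsHarmoniousFunctions.card_le (h : IsHarmoniousFunctions v c) :
    n * (n - 1) * l ≤ n.choose 2 + (k - n) * (2 * (n / 2)) := by
  classical
  rw [← card_ordered_pairs, ← Finset.card_filter_add_card_filter_not
    (fun t : Fin n × Fin n × Fin l => ∃ z, v z = c t.1 t.2.1 t.2.2), Finset.filter_filter,
    Finset.filter_filter]
  refine add_le_add h.card_vertexColoured_le ?_
  rw [← card_compl_image h.injective, Finset.card_eq_sum_card_fiberwise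
    (f := fun t : Fin n × Fin n × Fin l => c t.1 t.2.1 t.2.2)
    (t := (Finset.univ : Finset (Fin k)).filter fun d => ∀ z, v z ≠ d), ← smul_eq_mul]
  · refine Finset.sum_le_card_nsmul _ _ _ fun d _ => (Finset.card_le_card ?_).trans
      (h.card_colour_le d)
    intro t ht
    simp only [Finset.mem_filter, Finset.mem_univ, true_and] at ht ⊢
    exact ⟨ht.1.1, ht.2⟩
  · intro t ht
    simp only [Finset.coe_filter, Finset.mem_univ, true_and, Set.mem_ofPred_eq, not_exists] at ht ⊢
    exact ht.2

theorem IsHarmoniousFunctions.card_vertices_le (h : IsHarmoniousFunctions v c) : n ≤ k := by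
  simpa using Fintype.card_le_of_injective v h.injective

theorem IsHarmoniousFunctions.le_of_even {m : ℕ} (hm : 1 ≤ m) (hn : n = 2 * m) (hl : 1 ≤ l)
    (h : IsHarmoniousFunctions v c) : (l - 1) * (2 * m - 1) + 3 * m ≤ k := by
  have h1 := h.card_le
  have h2 := h.card_vertices_le
  subst hn
  obtain ⟨q, rfl⟩ := Nat.exists_eq_add_of_le h2
  obtain ⟨r, rfl⟩ := Nat.exists_eq_add_of_le hl
  obtain ⟨m, rfl⟩ := Nat.exists_eq_add_of_le hm
  have e1 : (2 * (1 + m)).choose 2 = (1 + m) * (2 * m + 1) := by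
    rw [Nat.choose_two_right, show 2 * (1 + m) - 1 = 2 * m + 1 by omega, mul_assoc,
      Nat.mul_div_cancel_left _ (by omega)]
  rw [e1, show 2 * (1 + m) - 1 = 2 * m + 1 by omega,
    show 2 * (1 + m) / 2 = 1 + m by omega, Nat.add_sub_cancel_left] at h1
  rw [show 2 * (1 + m) - 1 = 2 * m + 1 by omega, Nat.add_sub_cancel_left]
  have h3 : (1 + m) * (2 * (2 * m + 1) * (1 + r)) ≤ (1 + m) * (2 * m + 1 + 2 * q) := by
    linarith
  have h4 := Nat.le_of_mul_le_mul_left h3 (by omega)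
  -- After cancelling, `2 * q` is at least an odd number, since `2 * m + 1` is odd; `omega` rounds
  -- up, with `r * (2 * m + 1)` as an atom.
  have h5 : 2 * (2 * m + 1) * (1 + r) = 2 * (r * (2 * m + 1)) + 2 * (2 * m + 1) := by ring
  omega

theorem IsHarmoniousFunctions.le_of_odd {m : ℕ} (hm : 1 ≤ m) (hn : n = 2 * m + 1) (hl : 1 ≤ l)
    (h : IsHarmoniousFunctions v c) : (l - 1) * (2 * m + 1) + (3 * m + 2) ≤ k := by
  have h1 := h.card_le
  have h2 := h.card_vertices_le
  subst hn
  obtain ⟨q, rfl⟩ := Nat.exists_eq_add_of_le h2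
  obtain ⟨r, rfl⟩ := Nat.exists_eq_add_of_le hl
  have e1 : (2 * m + 1).choose 2 = (2 * m + 1) * m := by
    rw [Nat.choose_two_right, Nat.add_sub_cancel, show (2 * m + 1) * (2 * m) =
      2 * ((2 * m + 1) * m) by ring, Nat.mul_div_cancel_left _ (by omega)]
  rw [e1, Nat.add_sub_cancel, show (2 * m + 1) / 2 = m by omega, Nat.add_sub_cancel_left] at h1
  rw [Nat.add_sub_cancel_left]
  have h3 : m * (2 * (2 * m + 1) * (1 + r)) ≤ m * (2 * m + 1 + 2 * q) := by
    linarith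
  have h4 := Nat.le_of_mul_le_mul_left h3 (by omega)
  have h5 : 2 * (2 * m + 1) * (1 + r) = 2 * (r * (2 * m + 1)) + 2 * (2 * m + 1) := by ring
  omega

end Counting

/-! ### The exceptional order four -/

section Four

variable {l k : ℕ} {v : Fin 4 → Fin k} {c : Fin 4 → Fin 4 → Fin l → Fin k}

/-- The colour of `x y` must belong to one of `z`, `w`, and that of `z w` to one of `x`, `y`; these
two vertices then carry opposite arcs. -/
theorem IsHarmoniousFunctions.not_disjoint (h : IsHarmoniousFunctions v c) {x y z w : Fin 4}
    (hxy : y ≠ x) (hzw : w ≠ z) (hxz : z ≠ x) (hxw : w ≠ x) (hyz : z ≠ y) (hyw : w ≠ y)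
    {i j : Fin l} {p q : Fin 4} (hp : v p = c x y i) (hq : v q = c z w j) : False := by
  have hpx : p ≠ x := fun e => h.incident x y i hxy (e ▸ hp)
  have hpy : p ≠ y := fun e => h.incident y x i hxy.symm (by rw [h.symm]; exact e ▸ hp)
  have hqz : q ≠ z := fun e => h.incident z w j hzw (e ▸ hq)
  have hqw : q ≠ w := fun e => h.incident w z j hzw.symm (by rw [h.symm]; exact e ▸ hq)
  have hp' : p = z ∨ p = w := by omega
  have hq' : q = x ∨ q = y := by omega
  have hp2 : v p = c y x i := by rw [h.symm, hp]
  have hq2 : v q = c w z j := by rw [h.symm, hq]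
  rcases hp' with rfl | rfl <;> rcases hq' with rfl | rfl
  · exact h.pair _ _ _ _ _ _ hxy hzw hq hp
  · exact h.pair _ _ _ _ _ _ hxy.symm hzw hq hp2
  · exact h.pair _ _ _ _ _ _ hxy hzw.symm hq2 hp
  · exact h.pair _ _ _ _ _ _ hxy.symm hzw.symm hq2 hp2

theorem IsHarmoniousFunctions.le_of_injective (h : IsHarmoniousFunctions v c)
    (f : Fin 3 × Fin l → Fin k) (hf : Function.Injective f) (hfv : ∀ t z, v z ≠ f t) :
    3 * l + 4 ≤ k := by
  have := Fintype.card_le_of_injective (Sum.elim v f) (h.injective.sumElim hf fun z t => hfv t z)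
  simp only [Fintype.card_sum, Fintype.card_fin, Fintype.card_prod] at this
  omega

/-- A graph on four vertices without isolated vertices and without two disjoint edges has a vertex
adjacent to all others. -/
theorem exists_centre (P : Fin 4 → Fin 4 → Prop) (hsymm : ∀ x y, P x y → P y x)
    (hP : ∀ x, ∃ y, y ≠ x ∧ P x y)
    (hdisj : ∀ x y z w, y ≠ x → w ≠ z → z ≠ x → w ≠ x → z ≠ y → w ≠ y → P x y → ¬ P z w) :
    ∃ x, ∀ y, y ≠ x → P x y := by
  obtain ⟨a, ha, hPa⟩ := hP 0
  obtain ⟨z, w, hz0, hw0, hza, hwa, hwz, hall⟩ : ∃ z w : Fin 4, z ≠ 0 ∧ w ≠ 0 ∧ z ≠ a ∧ w ≠ a ∧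
      w ≠ z ∧ ∀ t, t = 0 ∨ t = a ∨ t = z ∨ t = w := by
    clear hPa
    revert a
    decide
  obtain ⟨s, hs, hPs⟩ := hP z
  obtain ⟨t, ht, hPt⟩ := hP w
  -- Neither `z` nor `w` can have the other as neighbour, and attaching them to different ends of
  -- the pair `0`, `a` would give disjoint pairs; their common end is the centre.
  have h1 := hdisj 0 a z w ha hwz hz0 hw0 hza hwa hPa
  have h2 := hdisj z 0 w a hz0.symm hwa.symm hwz hza.symm hw0 ha
  have h3 := hdisj z a w 0 hza.symm hw0.symm hwz hz0.symm hwa ha.symm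
  have hs' : s = 0 ∨ s = a := by
    rcases hall s with rfl | rfl | rfl | rfl <;> tauto
  have ht' : t = 0 ∨ t = a := by
    rcases hall t with rfl | rfl | rfl | rfl
    · exact .inl rfl
    · exact .inr rfl
    · exact absurd (hsymm _ _ hPt) h1
    · exact absurd rfl ht
  rcases hs' with rfl | rfl <;> rcases ht' with rfl | rfl
  · refine ⟨0, fun y hy => ?_⟩
    rcases hall y with rfl | rfl | rfl | rfl
    exacts [absurd rfl hy, hPa, hsymm _ _ hPs, hsymm _ _ hPt]
  · exact absurd hPt (h2 hPs)
  · exact absurd hPt (h3 hPs)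
  · refine ⟨t, fun y hy => ?_⟩
    rcases hall y with rfl | rfl | rfl | rfl
    exacts [hsymm _ _ hPa, absurd rfl hy, hsymm _ _ hPs, hsymm _ _ hPt]

/-- If some vertex meets no vertex-coloured edge, its star has `3 * l` further colours. Otherwise
the vertex-coloured pairs contain a full star, and the triangle opposite its centre is free of
vertex colours; its edges pairwise meet. -/
theorem IsHarmoniousFunctions.three_mul_add_four_le (h : IsHarmoniousFunctions v c) :
    3 * l + 4 ≤ k := by
  by_cases hstar : ∃ x, ∀ y i z, y ≠ x → v z ≠ c x y i
  · obtain ⟨x, hx⟩ := hstar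
    refine h.le_of_injective (fun t => c x (x.succAbove t.1) t.2) ?_
      fun t z => hx _ _ _ (Fin.succAbove_ne _ _)
    rintro ⟨a, i⟩ ⟨b, j⟩ he
    obtain ⟨h1, h2⟩ := h.proper _ _ _ _ _ (Fin.succAbove_ne _ _) (Fin.succAbove_ne _ _) he
    exact Prod.ext (Fin.succAbove_right_injective h1) h2
  · push Not at hstar
    obtain ⟨x, hx⟩ : ∃ x, ∀ y, y ≠ x → ∃ i z, v z = c x y i := by
      refine exists_centre (fun x y => ∃ i z, v z = c x y i) ?_ ?_ ?_
      · rintro x y ⟨i, z, hz⟩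
        exact ⟨i, z, by rw [h.symm, hz]⟩
      · intro x
        obtain ⟨y, i, z, hy, hz⟩ := hstar x
        exact ⟨y, hy, i, z, hz⟩
      · rintro x y z w hxy hzw hxz hxw hyz hyw ⟨i, p, hp⟩ ⟨j, q, hq⟩
        exact h.not_disjoint hxy hzw hxz hxw hyz hyw hp hq
    have hinj := Fin.succAbove_right_injective (p := x)
    have h12 : ∀ t : Fin 3, t + 1 ≠ t ∧ t + 2 ≠ t ∧ t + 2 ≠ t + 1 ∧ t + 1 + 2 = t ∧
        t + 1 + 1 = t + 2 ∧ t + 2 + 1 = t ∧ t + 2 + 2 = t + 1 := by decide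
    refine h.le_of_injective
      -- A side of the triangle is indexed by its opposite corner, whose spoke to `x` is the
      -- disjoint pair.
      (fun t => c (x.succAbove (t.1 + 1)) (x.succAbove (t.1 + 2)) t.2) ?_ ?_
    · rintro ⟨t, i⟩ ⟨s, j⟩ he
      simp only at he
      obtain ⟨n1, n2, n3, e1, e2, e3, e4⟩ := h12 t
      have hs : ∀ t s : Fin 3, s = t ∨ s = t + 1 ∨ s = t + 2 := by decide
      rcases hs t s with rfl | rfl | rfl
      · obtain ⟨-, rfl⟩ := h.proper _ _ _ _ _ (hinj.ne n3) (hinj.ne n3) he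
        rfl
      · rw [e1, e2, h.symm] at he
        exact absurd (hinj (h.proper _ _ _ _ _ (hinj.ne n3.symm) (hinj.ne n2.symm) he).1) n1
      · rw [e3, e4, h.symm (x.succAbove t)] at he
        exact absurd (hinj (h.proper _ _ _ _ _ (hinj.ne n3) (hinj.ne n1.symm) he).1) n2
    · rintro ⟨t, i⟩ z hz
      obtain ⟨n1, n2, n3, -⟩ := h12 t
      obtain ⟨j, q, hq⟩ := hx (x.succAbove t) (Fin.succAbove_ne _ _)
      exact h.not_disjoint (Fin.succAbove_ne _ _) (hinj.ne n3) (Fin.succAbove_ne _ _)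
        (Fin.succAbove_ne _ _) (hinj.ne n1) (hinj.ne n2) hq hz

end Four

/-! ### Assembling the bounds -/

/-- The edge colouring of the complete graph using no vertex colours. -/
theorem IsProperEdgeFunction.isHarmoniousRelation {V X : Type*} {g : V → V → X}
    (hg : IsProperEdgeFunction g) :
    IsHarmoniousRelation fun (c : V ⊕ X) x y => x ≠ y ∧ c = .inr (g x y) where
  cover x y hxy := ⟨_, .inl ⟨hxy, rfl⟩⟩
  proper c x y z h1 h2 := by
    have h1 : x ≠ y ∧ c = .inr (g x y) := h1.elim id fun h => ⟨h.1.symm, by rw [h.2, hg.symm]⟩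
    have h2 : x ≠ z ∧ c = .inr (g x z) := h2.elim id fun h => ⟨h.1.symm, by rw [h.2, hg.symm]⟩
    exact hg.inj _ _ _ h1.1.symm h2.1.symm (Sum.inr.inj (h1.2.symm.trans h2.2))
  irrefl x y h := by simp at h
  asymm x y z w h := by simp at h

theorem harmoniousTotalChromaticNumber_eq {α β : Type*} {G : Graph α β} {k : ℕ}
    (h : HarmoniousTotalColourable G k) (hmin : ∀ q, HarmoniousTotalColourable G q → k ≤ q) :
    harmoniousTotalChromaticNumber G = k :=
  le_antisymm (iInf₂_le k h) (le_iInf₂ fun q hq => Nat.cast_le.2 (hmin q hq))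

theorem harmoniousTotalColourable_even {m l : ℕ} (hm : 1 ≤ m) (hm2 : m ≠ 2) :
    HarmoniousTotalColourable (completeMultigraph (2 * m) l)
      ((l - 1) * (2 * m - 1) + 3 * m) := by
  rcases Nat.even_or_odd' m with ⟨N, rfl | rfl⟩
  · obtain ⟨g, hg⟩ := exists_isProperEdgeFunction (Fin (2 * N)) (q := 2 * N - 1)
      ⟨N - 1, by omega⟩ (by simp only [Fintype.card_fin]; omega)
    obtain ⟨g', hg'⟩ := exists_isProperEdgeFunction (Fin (2 * N) ⊕ Fin (2 * N))
      (q := 2 * (2 * N) - 1) ⟨2 * N - 1, by omega⟩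
      (by simp only [Fintype.card_sum, Fintype.card_fin]; omega)
    -- Excluding `m = 2` gives `2 ≤ N`, so that the position `N - 2` exists.
    convert (isHarmoniousRelation_fourMul (by omega) hg).colourable hg' (n := 2 * (2 * N)) (l := l)
      (by simp only [Fintype.card_sum, Fintype.card_fin]; omega) (by omega) using 1
    simp only [Fintype.card_option, Fintype.card_fin]
    omega
  · obtain ⟨g, hg⟩ := exists_isProperEdgeFunction (Fin (2 * N + 1) ⊕ Fin (2 * N + 1))
      (q := 2 * (2 * N + 1) - 1) ⟨2 * N, by omega⟩
      (by simp only [Fintype.card_sum, Fintype.card_fin]; omega)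
    convert (isHarmoniousRelation_twiceOdd N).colourable hg (n := 2 * (2 * N + 1)) (l := l)
      (by simp only [Fintype.card_sum, Fintype.card_fin]; omega) (by omega) using 1
    simp only [Fintype.card_fin]
    omega

theorem harmoniousTotalColourable_odd {m l : ℕ} :
    HarmoniousTotalColourable (completeMultigraph (2 * m + 1) l)
      ((l - 1) * (2 * m + 1) + (3 * m + 2)) := by
  rcases Nat.even_or_odd' m with ⟨N, rfl | rfl⟩
  · obtain ⟨g, hg⟩ := exists_isProperEdgeFunction (Option (Fin (2 * N) ⊕ Fin (2 * N)))
      (q := 2 * (2 * N) + 1) ⟨2 * N, by omega⟩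
      (by simp only [Fintype.card_option, Fintype.card_sum, Fintype.card_fin]; omega)
    convert (isHarmoniousRelation_fourMulSucc N).colourable hg (n := 2 * (2 * N) + 1) (l := l)
      (by simp only [Fintype.card_option, Fintype.card_sum, Fintype.card_fin]; omega)
      (by omega) using 1
    simp only [Fintype.card_option, Fintype.card_fin]
    omega
  · obtain ⟨g, hg⟩ := exists_isProperEdgeFunction (Option (Fin (2 * N + 1) ⊕ Fin (2 * N + 1)))
      (q := 2 * (2 * N + 1) + 1) ⟨2 * N + 1, by omega⟩
      (by simp only [Fintype.card_option, Fintype.card_sum, Fintype.card_fin]; omega)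
    convert (isHarmoniousRelation_twiceOddSucc N).colourable hg (n := 2 * (2 * N + 1) + 1) (l := l)
      (by simp only [Fintype.card_option, Fintype.card_sum, Fintype.card_fin]; omega)
      (by omega) using 1
    simp only [Fintype.card_option, Fintype.card_fin]
    omega

theorem harmoniousTotalColourable_four {l : ℕ} (hl : 1 ≤ l) :
    HarmoniousTotalColourable (completeMultigraph 4 l) (3 * l + 4) := by
  obtain ⟨g, hg⟩ := exists_isProperEdgeFunction (Fin 4) (q := 3) ⟨1, rfl⟩ (.inr rfl)
  convert hg.isHarmoniousRelation.colourable hg (n := 4) (l := l) (by simp) (by omega) using 1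
  simp only [Fintype.card_fin]
  omega

theorem ceil_half_even (m : ℕ) : ⌈((2 * m : ℕ) : ℚ) / 2⌉₊ = m := by
  rw [show ((2 * m : ℕ) : ℚ) / 2 = (m : ℕ) by push_cast; ring, Nat.ceil_natCast]

theorem ceil_three_halves_even (m : ℕ) : ⌈3 * ((2 * m : ℕ) : ℚ) / 2⌉₊ = 3 * m := by
  rw [show 3 * ((2 * m : ℕ) : ℚ) / 2 = (3 * m : ℕ) by push_cast; ring, Nat.ceil_natCast]

theorem ceil_half_odd (m : ℕ) : ⌈((2 * m + 1 : ℕ) : ℚ) / 2⌉₊ = m + 1 := by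
  rw [Nat.ceil_eq_iff (by omega), Nat.add_sub_cancel]
  push_cast
  constructor <;> linarith

theorem ceil_three_halves_odd (m : ℕ) : ⌈3 * ((2 * m + 1 : ℕ) : ℚ) / 2⌉₊ = 3 * m + 2 := by
  rw [Nat.ceil_eq_iff (by omega), show 3 * m + 2 - 1 = 3 * m + 1 by omega]
  push_cast
  constructor <;> linarith

theorem theorem3 (l : ℕ) (hl : 1 ≤ l) :
    (∀ n : ℕ, 2 ≤ n → n ≠ 4 →
      harmoniousTotalChromaticNumber (completeMultigraph n l) =
        (((l - 1) * (2 * ⌈(n : ℚ) / 2⌉₊ - 1) + ⌈3 * (n : ℚ) / 2⌉₊ : ℕ) : ℕ∞)) ∧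
    harmoniousTotalChromaticNumber (completeMultigraph 4 l) = ((3 * l + 4 : ℕ) : ℕ∞) := by
  refine ⟨fun n hn hn4 => ?_, ?_⟩
  · rcases Nat.even_or_odd' n with ⟨m, rfl | rfl⟩
    · rw [ceil_half_even, ceil_three_halves_even]
      refine harmoniousTotalChromaticNumber_eq
        (harmoniousTotalColourable_even (by omega) (by omega)) fun q hq => ?_
      obtain ⟨v, c, h⟩ := hq.exists_functions hl
      exact h.le_of_even (by omega) rfl hl
    · rw [ceil_half_odd, ceil_three_halves_odd, show 2 * (m + 1) - 1 = 2 * m + 1 by omega]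
      refine harmoniousTotalChromaticNumber_eq harmoniousTotalColourable_odd fun q hq => ?_
      obtain ⟨v, c, h⟩ := hq.exists_functions hl
      exact h.le_of_odd (by omega) rfl hl
  · refine harmoniousTotalChromaticNumber_eq (harmoniousTotalColourable_four hl) fun q hq => ?_
    obtain ⟨v, c, h⟩ := hq.exists_functions hl
    exact h.three_mul_add_four_le
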